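/- Let $N,k,l\ge 0$ be integers, let $\theta>0$ and $a>-1$ be real, let $\kappa=(\kappa_1,\dots,\kappa_k)$ with $\kappa_i\in\mathbb C\setminus[0,\infty)$ and $\lambda=(\lambda_1,\dots,\lambda_l)\in\mathbb C^l$. Define the generalised partition function of the $\theta$-deformed Bures ensemble $$Z^{(N,a,B)}_{k|l}(\kappa,\lambda)=\frac1{N!}\int_{\mathbb R_+^N}\prod_{1\le i<j\le N}\frac{x_j-x_i}{x_j+x_i}\,(x_j^\theta-x_i^\theta)\;\prod_{j=1}^N\frac{\prod_{i=1}^l(x_j^\theta-\lambda_i)}{\prod_{i=1}^k(x_j-\kappa_i)}\,x_j^a e^{-x_j}\,dx_j$$ and, for real $b>-1$, the generalised partition function of the $\theta$-deformed Cauchy two-matrix model $$Z^{(N,a,b,C)}_{k_1|l_1;k_2|l_2}(\kappa_1,\lambda_1;\kappa_2,\lambda_2)=\frac1{(N!)^2}\int_{\mathbb R_+^N\times\mathbb R_+^N}\frac{\prod_{1\le i<j\le N}(x_j-x_i)(y_j-y_i)}{\prod_{i,j=1}^N(x_i+y_j)}\prod_{1\le i<j\le N}(x_j^\theta-x_i^\theta)(y_j^\theta-y_i^\theta)$$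 $$\times\prod_{j=1}^N x_j^ae^{-x_j}\,y_j^be^{-y_j}\,\frac{\prod_{i=1}^{l_1}(x_j^\theta-\lambda_{1,i})\prod_{i=1}^{l_2}(y_j^\theta-\lambda_{2,i})}{\prod_{i=1}^{k_1}(x_j-\kappa_{1,i})\prod_{i=1}^{k_2}(y_j-\kappa_{2,i})}\,dx_j\,dy_j .$$ Then the integrals defining $Z^{(N,a,B)}_{k|l}(\kappa,\lambda)$ and $Z^{(N,a,a+1,C)}_{k|l;k|l}(\kappa,\lambda;\kappa,\lambda)$ converge absolutely, and $$\bigl(Z^{(N,a,B)}_{k|l}(\kappa,\lambda)\bigr)^2=2^N\,Z^{(N,a,a+1,C)}_{k|l;k|l}(\kappa,\lambda;\kappa,\lambda).$$ -/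

import Mathlib

open MeasureTheory

namespace ThetaBures

/-- The open positive orthant `ℝ₊ᴺ`. -/
def orthant (N : ℕ) : Set (Fin N → ℝ) :=
  Set.univ.pi fun _ => Set.Ioi 0

/-- The Vandermonde product `∏_{i < j} (z_j - z_i)`. -/
noncomputable def vandermondeProd {N : ℕ} (z : Fin N → ℝ) : ℝ :=
  ∏ i, ∏ j ∈ Finset.Ioi i, (z j - z i)

/-- The Laguerre weight `x ^ a * e ^ (-x)` times the ratio of characteristic factors
`∏ᵢ (x ^ θ - lam i) / ∏ᵢ (x - κ i)`. -/
noncomputable def charWeight {k l : ℕ} (θ a : ℝ) (κ : Fin k → ℂ) (lam : Fin l → ℂ) (x : ℝ) : ℂ :=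
  ((x ^ a * Real.exp (-x) : ℝ) : ℂ) *
    ((∏ i, (((x ^ θ : ℝ) : ℂ) - lam i)) / ∏ i, ((x : ℂ) - κ i))

/-- Integrand of the generalised partition function of the `θ`-deformed Bures ensemble. -/
noncomputable def buresIntegrand {N k l : ℕ} (θ a : ℝ) (κ : Fin k → ℂ) (lam : Fin l → ℂ)
    (x : Fin N → ℝ) : ℂ :=
  ((∏ i, ∏ j ∈ Finset.Ioi i, ((x j - x i) / (x j + x i) * (x j ^ θ - x i ^ θ)) : ℝ) : ℂ) *
    ∏ j, charWeight θ a κ lam (x j)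

/-- Generalised partition function of the `θ`-deformed Bures ensemble. -/
noncomputable def buresZ (N : ℕ) {k l : ℕ} (θ a : ℝ) (κ : Fin k → ℂ) (lam : Fin l → ℂ) : ℂ :=
  (1 / (N.factorial : ℂ)) * ∫ x in orthant N, buresIntegrand θ a κ lam x

/-- Integrand of the generalised partition function of the `θ`-deformed Cauchy two-matrix model. -/
noncomputable def cauchyIntegrand {N k₁ l₁ k₂ l₂ : ℕ} (θ a b : ℝ)
    (κ₁ : Fin k₁ → ℂ) (lam₁ : Fin l₁ → ℂ) (κ₂ : Fin k₂ → ℂ) (lam₂ : Fin l₂ → ℂ)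
    (p : (Fin N → ℝ) × (Fin N → ℝ)) : ℂ :=
  ((vandermondeProd p.1 * vandermondeProd p.2 / (∏ i, ∏ j, (p.1 i + p.2 j)) *
      (vandermondeProd (fun i => p.1 i ^ θ) * vandermondeProd (fun i => p.2 i ^ θ)) : ℝ) : ℂ) *
    ∏ j, (charWeight θ a κ₁ lam₁ (p.1 j) * charWeight θ b κ₂ lam₂ (p.2 j))

/-- Generalised partition function of the `θ`-deformed Cauchy two-matrix model. -/
noncomputable def cauchyZ (N : ℕ) {k₁ l₁ k₂ l₂ : ℕ} (θ a b : ℝ)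
    (κ₁ : Fin k₁ → ℂ) (lam₁ : Fin l₁ → ℂ) (κ₂ : Fin k₂ → ℂ) (lam₂ : Fin l₂ → ℂ) : ℂ :=
  (1 / (N.factorial : ℂ) ^ 2) *
    ∫ p in orthant N ×ˢ orthant N, cauchyIntegrand θ a b κ₁ lam₁ κ₂ lam₂ p

end ThetaBures

/-!
Two functions of `x ∈ ℝ₊ᴺ` govern the two ensembles: the Schur product
`∏_{i < j} (x_j - x_i) / (x_j + x_i)` and the determinant of `1 + (y_j - x_i) / (y_j + x_i)`,
which is the determinant of `2 y_j / (x_i + y_j)` and hence, by Cauchy, `2 ^ N` times the double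
Vandermonde factor of the two-matrix model with the extra `∏ y_j` that turns `b = a` into
`b = a + 1`.

By Lagrange interpolation the Schur product satisfies the expansion rule of a Pfaffian with entries
`(x_j - x_i) / (x_j + x_i)`, bordered by a row of ones when `N` is odd. Integrated against a Slater
determinant of functions `f_j`, it therefore becomes the (bordered) Pfaffian of the antisymmetric
Gram matrix `S i j = ∫∫ (y - x) / (y + x) f_i(x) f_j(y)` with border `u i = ∫ f_i` (de Bruijn).
In either parity its square is `det (S + u uᵀ)`, the Gram determinant of the kernel
`1 + (y - x) / (y + x)`, which Andréief's identity identifies with the integral over the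
two-matrix model.
-/

namespace ThetaBures

section Pfaffian

open scoped Matrix.Module

variable {K V ι : Type*} [Field K] [AddCommGroup V] [Module K V]

/-- The Gram matrix `(β (v i) (v j))` of a family of vectors with respect to a bilinear form. -/
def bilinGram (β : V →ₗ[K] V →ₗ[K] K) (v : ι → V) : Matrix ι ι K :=
  Matrix.of fun i j => β (v i) (v j)

theorem bilinGram_apply (β : V →ₗ[K] V →ₗ[K] K) (v : ι → V) (i j : ι) :
    bilinGram β v i j = β (v i) (v j) :=
  rfl

section BaseChange

variable [Fintype ι] [DecidableEq ι]

theorem alternatingMap_matrix_smul (F : V [⋀^ι]→ₗ[K] K) (v : ι → V) (B : Matrix ι ι K) :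
    F (B • v) = B.det * F v := by
  have h := DFunLike.congr_fun
    ((F.compLinearMap (Fintype.linearCombination K v)).eq_smul_basis_det (Pi.basisFun K ι))
    fun i j => B i j
  rw [AlternatingMap.smul_apply, Pi.basisFun_det_apply, AlternatingMap.compLinearMap_apply,
    AlternatingMap.compLinearMap_apply, smul_eq_mul, mul_comm] at h
  simp only [Fintype.linearCombination_apply, Pi.basisFun_apply, Pi.single_apply, ite_smul,
    one_smul, zero_smul, Finset.sum_ite_eq', Finset.mem_univ, if_true] at h
  rw [← show _ = B.det * F v from h]
  exact congrArg F (funext fun i => Matrix.Module.smul_apply B v i)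

theorem bilinGram_matrix_smul (β : V →ₗ[K] V →ₗ[K] K) (v : ι → V) (B : Matrix ι ι K) :
    bilinGram β (B • v) = B * bilinGram β v * B.transpose := by
  ext i j
  simp only [bilinGram_apply, Matrix.Module.smul_apply, map_sum, LinearMap.sum_apply, map_smul,
    LinearMap.smul_apply, smul_eq_mul, Matrix.mul_apply, Matrix.transpose_apply,
    Finset.sum_mul, Finset.mul_sum]
  exact Finset.sum_congr rfl fun _ _ => Finset.sum_congr rfl fun _ _ => by ring

theorem sq_eq_det_bilinGram_iff_matrix_smul (F : V [⋀^ι]→ₗ[K] K) (β : V →ₗ[K] V →ₗ[K] K)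
    (v : ι → V) {B : Matrix ι ι K} (hB : B.det ≠ 0) :
    F (B • v) ^ 2 = (bilinGram β (B • v)).det ↔ F v ^ 2 = (bilinGram β v).det := by
  rw [alternatingMap_matrix_smul, bilinGram_matrix_smul, Matrix.det_mul, Matrix.det_mul,
    Matrix.det_transpose, mul_pow, mul_right_comm, ← sq, mul_right_inj' (pow_ne_zero 2 hB)]

theorem exists_matrix_smul_eliminate (u : V →ₗ[K] K) (v : ι → V) (k : ι) :
    ∃ B : Matrix ι ι K, B.det ≠ 0 ∧ (∀ i ≠ k, u ((B • v) i) = 0) ∧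
      ∀ i ≠ k, u (v i) = 0 → (B • v) i = v i := by
  by_cases hu : ∀ j, u (v j) = 0
  · exact ⟨1, by simp, fun i _ => by rw [one_smul, hu], fun i _ _ => by rw [one_smul]⟩
  push Not at hu
  obtain ⟨j, hj⟩ := hu
  let σ := Equiv.swap j k
  let c : ι → K := fun i => if i = k then 0 else -(u (v (σ i)) / u (v j))
  let shear : Matrix ι ι K := Matrix.of fun i i' =>
    (1 : Matrix ι ι K) i i' + c i * (1 : Matrix ι ι K) k i'
  have hshear : shear.det = 1 := by
    rw [Matrix.det_eq_of_forall_row_eq_smul_add_const (A := shear) (B := 1) c k (if_pos rfl)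
      fun _ _ => rfl, Matrix.det_one]
  have hsmul : ∀ i, (shear.submatrix id σ • v) i = v (σ i) + c i • v j := by
    intro i
    rw [Matrix.Module.smul_apply, ← Equiv.sum_comp σ]
    simp [shear, σ, Matrix.one_apply, add_smul, Finset.sum_add_distrib]
  refine ⟨shear.submatrix id σ, ?_, fun i hi => ?_, fun i hi hui => ?_⟩
  · rw [Matrix.det_permute', hshear, mul_one]
    rcases Int.units_eq_one_or σ.sign with h | h <;> simp [h]
  · rw [hsmul, map_add, map_smul, smul_eq_mul]
    simp only [c, if_neg hi]
    field_simp
    ring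
  · have hij : i ≠ j := by rintro rfl; exact hj hui
    simp [hsmul, c, hi, σ, Equiv.swap_apply_of_ne_of_ne hij hi, hui]

end BaseChange

theorem det_bilinGram_of_pivot {ω : V →ₗ[K] V →ₗ[K] K} (hω : ω.IsAlt) {n : ℕ}
    (v : Fin (n + 2) → V) (hv : ∀ i ≠ 1, ω (v 0) (v i) = 0) :
    (bilinGram ω v).det =
      ω (v 0) (v 1) ^ 2 * (bilinGram ω fun i : Fin n => v i.succ.succ).det := by
  have hv0 : ∀ j : Fin n, ω (v 0) (v j.succ.succ) = 0 := fun j =>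
    hv _ (Fin.succ_injective _ |>.ne j.succ_ne_zero)
  have hv0' : ∀ j : Fin n, ω (v j.succ.succ) (v 0) = 0 := fun j => by
    rw [← hω.neg, hv0, neg_zero]
  have hminor : ((bilinGram ω v).submatrix Fin.succ (Fin.succAbove 1)).submatrix
      (Fin.succAbove 0) Fin.succ = bilinGram ω (fun i : Fin n => v i.succ.succ) := by
    ext i j
    simp [bilinGram_apply]
  rw [Matrix.det_succ_row_zero, Finset.sum_eq_single 1,
    Matrix.det_succ_column_zero (Matrix.submatrix _ _ (Fin.succAbove 1)), Finset.sum_eq_single 0,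
    hminor]
  · simp only [Fin.val_zero, Fin.val_one, pow_zero, pow_one, one_mul, neg_mul,
      Matrix.submatrix_apply, Fin.succ_zero_eq_one, Fin.one_succAbove_zero, bilinGram_apply,
      ← hω.neg (v 0) (v 1)]
    ring
  · intro i _ hi
    obtain ⟨j, rfl⟩ := Fin.exists_succ_eq.mpr hi
    simp [bilinGram_apply, hv0']
  · simp
  · intro i _ hi
    simp [bilinGram_apply, hv i hi]
  · simp

/-- A family of alternating maps, one in each degree, satisfying the expansion of the Pfaffian of
the matrix `(ω (v i) (v j))` along its first row. -/
structure IsPfaffian (ω : V →ₗ[K] V →ₗ[K] K) (P : ∀ n, V [⋀^Fin n]→ₗ[K] K) : Prop where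
  zero : ∀ v, P 0 v = 1
  one : ∀ v, P 1 v = 0
  add_two : ∀ n (v : Fin (n + 2) → V), P (n + 2) v =
    ∑ j : Fin (n + 1), (-1) ^ (j : ℕ) * ω (v 0) (v j.succ) * P n fun i => v (j.succAbove i).succ

theorem IsPfaffian.sq_eq_det {ω : V →ₗ[K] V →ₗ[K] K} (hω : ω.IsAlt)
    {P : ∀ n, V [⋀^Fin n]→ₗ[K] K} (hP : IsPfaffian ω P) :
    ∀ n (v : Fin n → V), P n v ^ 2 = (bilinGram ω v).det
  | 0, v => by rw [hP.zero, one_pow, Matrix.det_fin_zero]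
  | 1, v => by rw [hP.one, Matrix.det_fin_one, bilinGram_apply, hω, sq, zero_mul]
  | n + 2, v => by
    -- Both sides scale by `B.det ^ 2`, so `v` may be replaced by a family with `ω (v 0) (v i) = 0`
    -- for `i ≠ 1`, for which both expansions have a single term.
    obtain ⟨B, hB, hBv, hfix⟩ := exists_matrix_smul_eliminate (ω (v 0)) v 1
    rw [← sq_eq_det_bilinGram_iff_matrix_smul _ ω v hB]
    rw [← hfix 0 zero_ne_one (hω _)] at hBv
    have hexpand : P (n + 2) (B • v) =
        ω ((B • v) 0) ((B • v) 1) * P n fun i => (B • v) i.succ.succ := by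
      rw [hP.add_two, Finset.sum_eq_single 0]
      · simp
      · intro j _ hj
        rw [hBv _ (Fin.succ_injective _ |>.ne hj), mul_zero, zero_mul]
      · simp
    rw [det_bilinGram_of_pivot hω _ hBv, hexpand, mul_pow, hP.sq_eq_det hω n]

theorem det_bilinGram_add_smulRight (ω : V →ₗ[K] V →ₗ[K] K) (u : V →ₗ[K] K) {n : ℕ}
    (v : Fin (n + 1) → V) (hv : ∀ i ≠ 0, u (v i) = 0) :
    (bilinGram (ω + u.smulRight u) v).det =
      (bilinGram ω v).det + u (v 0) ^ 2 * (bilinGram ω fun i : Fin n => v i.succ).det := by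
  have hminor : ∀ j : Fin (n + 1),
      (bilinGram (ω + u.smulRight u) v).submatrix Fin.succ j.succAbove =
        (bilinGram ω v).submatrix Fin.succ j.succAbove := by
    intro j
    ext i k
    simp [bilinGram_apply, hv]
  have hrow : ∀ j, bilinGram (ω + u.smulRight u) v 0 j =
      bilinGram ω v 0 j + u (v 0) * u (v j) := fun _ => rfl
  have hborder : ∑ j : Fin (n + 1), (-1) ^ (j : ℕ) * (u (v 0) * u (v j)) *
      ((bilinGram ω v).submatrix Fin.succ j.succAbove).det =
        u (v 0) ^ 2 * (bilinGram ω fun i : Fin n => v i.succ).det := by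
    rw [Finset.sum_eq_single 0 (fun j _ hj => by rw [hv j hj, mul_zero, mul_zero, zero_mul])
      (by simp), Fin.val_zero, pow_zero, one_mul, sq]
    rfl
  rw [Matrix.det_succ_row_zero, Matrix.det_succ_row_zero (bilinGram ω v), ← hborder]
  simp only [hminor, hrow, mul_add, add_mul, Finset.sum_add_distrib]

/-- A family of alternating maps, one in each degree, which satisfies in even degree the expansion
of the Pfaffian of `(ω (v i) (v j))`, and in odd degree that of the same matrix bordered by the
row `(u (v i))`. -/
structure IsBorderedPfaffian (ω : V →ₗ[K] V →ₗ[K] K) (u : V →ₗ[K] K)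
    (P : ∀ n, V [⋀^Fin n]→ₗ[K] K) : Prop where
  zero : ∀ v, P 0 v = 1
  even_add_two : ∀ n, Even n → ∀ v : Fin (n + 2) → V, P (n + 2) v =
    ∑ j : Fin (n + 1), (-1) ^ (j : ℕ) * ω (v 0) (v j.succ) * P n fun i => v (j.succAbove i).succ
  even_add_one : ∀ n, Even n → ∀ v : Fin (n + 1) → V, P (n + 1) v =
    ∑ j : Fin (n + 1), (-1) ^ (j : ℕ) * u (v j) * P n fun i => v (j.succAbove i)

namespace IsBorderedPfaffian

variable {ω : V →ₗ[K] V →ₗ[K] K} {u : V →ₗ[K] K} {P : ∀ n, V [⋀^Fin n]→ₗ[K] K}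

theorem isPfaffian_ite_even (hP : IsBorderedPfaffian ω u P) :
    IsPfaffian ω fun n => if Even n then P n else 0 where
  zero v := by simp [hP.zero]
  one v := by simp
  add_two n v := by
    by_cases hn : Even n
    · simp [Nat.even_add_one, hn, hP.even_add_two]
    · simp [Nat.even_add_one, hn]

theorem sq_eq_det (hP : IsBorderedPfaffian ω u P) (hω : ω.IsAlt) :
    ∀ n (v : Fin n → V), P n v ^ 2 = (bilinGram (ω + u.smulRight u) v).det
  | 0, v => by rw [hP.zero, one_pow, Matrix.det_fin_zero]
  | n + 1, v => by
    obtain ⟨B, hB, hBv, -⟩ := exists_matrix_smul_eliminate u v 0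
    rw [← sq_eq_det_bilinGram_iff_matrix_smul _ _ v hB, det_bilinGram_add_smulRight _ _ _ hBv,
      ← hP.isPfaffian_ite_even.sq_eq_det hω, ← hP.isPfaffian_ite_even.sq_eq_det hω]
    by_cases hn : Even n
    · have hexpand : P (n + 1) (B • v) = u ((B • v) 0) * P n fun i => (B • v) i.succ := by
        rw [hP.even_add_one n hn, Finset.sum_eq_single 0]
        · simp
        · intro j _ hj
          rw [hBv j hj, mul_zero, zero_mul]
        · simp
      simp [hexpand, hn, Nat.even_add_one, mul_pow]
    · simp [hn, Nat.even_add_one]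

end IsBorderedPfaffian

end Pfaffian

section SchurProduct

variable {K : Type*} [Field K]

/-- The kernel `(b - a) / (b + a)` of the Schur product. -/
def schurKernel (a b : K) : K :=
  (b - a) / (b + a)

/-- The product `∏_{i < j} (x_j - x_i) / (x_j + x_i)`, called the Schur product because it equals
the Schur Pfaffian of the matrix of entries `(x_j - x_i) / (x_j + x_i)` for an even number of
variables. -/
def schurProd {n : ℕ} (x : Fin n → K) : K :=
  ∏ i, ∏ j ∈ Finset.Ioi i, schurKernel (x i) (x j)

theorem schurKernel_swap (a b : K) : schurKernel a b = -schurKernel b a := by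
  rw [schurKernel, schurKernel, ← neg_div, neg_sub, add_comm]

theorem one_add_schurKernel {a b : K} (h : b + a ≠ 0) :
    1 + schurKernel a b = 2 * b / (b + a) := by
  rw [schurKernel, one_add_div h]
  ring

theorem schurProd_comp_perm {n : ℕ} (x : Fin n → K) (σ : Equiv.Perm (Fin n)) :
    schurProd (x ∘ σ) = (Equiv.Perm.sign σ : ℤ) * schurProd x :=
  σ.prod_Ioi_comp_eq_sign_mul_prod (f := fun i j => schurKernel (x i) (x j))
    fun _ _ => schurKernel_swap _ _

theorem schurProd_succ {n : ℕ} (x : Fin (n + 1) → K) :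
    schurProd x = (∏ i : Fin n, schurKernel (x 0) (x i.succ)) * schurProd fun i => x i.succ := by
  simp only [schurProd, Fin.prod_univ_succ (n := n), Fin.prod_Ioi_zero, Fin.prod_Ioi_succ]

theorem schurProd_succAbove {n : ℕ} (x : Fin (n + 1) → K) (j : Fin (n + 1)) :
    (-1) ^ (j : ℕ) * schurProd x =
      (∏ i, schurKernel (x j) (x (j.succAbove i))) * schurProd fun i => x (j.succAbove i) := by
  have h := schurProd_comp_perm x j.cycleRange.symm
  rw [schurProd_succ] at h
  simpa [Fin.cycleRange_symm_zero, Fin.cycleRange_symm_succ, Fin.sign_cycleRange] using h.symm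

theorem prod_div_eq_one_add_sum_residues {ι : Type*} [DecidableEq ι] (s : Finset ι)
    {a : ι → K} (b : ι → K) (ha : Set.InjOn a s) {t : K} (ht : ∀ i ∈ s, t ≠ a i) :
    ∏ i ∈ s, (t - b i) / (t - a i) =
      1 + ∑ j ∈ s, (a j - b j) / (t - a j) * ∏ i ∈ s.erase j, (a j - b i) / (a j - a i) := by
  open Polynomial in
  let D : K[X] := ∏ i ∈ s, (X - C (b i)) - Lagrange.nodal s a
  have hdeg : D.degree < s.card := by
    have hb : (∏ i ∈ s, (X - C (b i))).degree = (s.card : WithBot ℕ) := Lagrange.degree_nodal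
    rw [← hb]
    refine degree_sub_lt_left (hb.trans Lagrange.degree_nodal.symm)
      (monic_prod_X_sub_C _ _).ne_zero ?_
    rw [(monic_prod_X_sub_C _ _).leadingCoeff, Lagrange.nodal_monic.leadingCoeff]
  have hnode : ∀ j ∈ s, D.eval (a j) = (a j - b j) * ∏ i ∈ s.erase j, (a j - b i) := fun j hj => by
    rw [Finset.mul_prod_erase s (fun i => a j - b i) hj, eval_sub,
      Lagrange.eval_nodal_at_node hj, sub_zero, eval_prod]
    simp
  have heval : D.eval t = ∏ i ∈ s, (t - b i) - ∏ i ∈ s, (t - a i) := by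
    simp [D, eval_prod, Lagrange.eval_nodal]
  have hprod : ∏ i ∈ s, (t - a i) ≠ 0 := Finset.prod_ne_zero_iff.mpr fun i hi =>
    sub_ne_zero.mpr (ht i hi)
  have hinterp := congrArg (eval t) (Lagrange.eq_interpolate ha hdeg)
  rw [Lagrange.eval_interpolate_not_at_node _ ht, heval, Lagrange.eval_nodal, sub_eq_iff_eq_add',
    ← mul_one_add, mul_comm, ← div_eq_iff hprod, ← Finset.prod_div_distrib] at hinterp
  rw [hinterp, Finset.sum_congr rfl fun j hj => ?_]
  rw [hnode j hj, Lagrange.nodalWeight, Finset.prod_div_distrib, Finset.prod_inv_distrib]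
  ring

section Expansion

variable {n : ℕ} {y : Fin (n + 1) → K}

theorem one_add_prod_schurKernel (hn : Even n) (hinj : Function.Injective y) {t : K}
    (ht : ∀ i, y i + t ≠ 0) :
    1 + ∏ i, schurKernel t (y i) =
      ∑ j, (1 + schurKernel t (y j)) * (∏ i, schurKernel (y j) (y (j.succAbove i)))⁻¹ := by
  have hres := prod_div_eq_one_add_sum_residues Finset.univ (a := fun i => -y i) y
    (neg_injective.comp hinj).injOn (t := t) fun i _ h => ht i (by rw [h]; ring)
  have hleft : ∏ i, (t - y i) / (t - -y i) = -∏ i, schurKernel t (y i) := by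
    have hneg : ∀ i, (t - y i) / (t - -y i) = -schurKernel t (y i) := fun i => by
      rw [schurKernel, ← neg_div, neg_sub, sub_neg_eq_add, add_comm]
    rw [Finset.prod_congr rfl fun i _ => hneg i, Finset.prod_neg, Finset.card_univ,
      Fintype.card_fin, hn.add_one.neg_one_pow, neg_one_mul]
  have hright : ∀ j, ∏ i ∈ Finset.univ.erase j, (-y j - y i) / (-y j - -y i) =
      (∏ i, schurKernel (y j) (y (j.succAbove i)))⁻¹ := fun j => by
    have hneg : ∀ i, (-y j - y i) / (-y j - -y i) = -(schurKernel (y j) (y i))⁻¹ := fun i => by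
      rw [schurKernel, inv_div, ← neg_div]
      ring
    rw [← Finset.compl_singleton, ← Fin.image_succAbove_univ,
      Finset.prod_image (Fin.succAbove_right_injective.injOn),
      Finset.prod_congr rfl fun i _ => hneg _, Finset.prod_neg, Finset.card_univ,
      Fintype.card_fin, hn.neg_one_pow, one_mul, Finset.prod_inv_distrib]
  have hcoeff : ∀ j, (-y j - y j) / (t - -y j) = -(1 + schurKernel t (y j)) := fun j => by
    rw [one_add_schurKernel (ht j)]
    ring
  simp only [hleft, hright, hcoeff, neg_mul, Finset.sum_neg_distrib] at hres
  linear_combination -hres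

theorem sum_inv_prod_schurKernel [NeZero (2 : K)] (hn : Even n) (hinj : Function.Injective y)
    (hy : ∀ i, y i ≠ 0) : ∑ j, (∏ i, schurKernel (y j) (y (j.succAbove i)))⁻¹ = 1 := by
  have h0 : ∀ i, schurKernel 0 (y i) = 1 := fun i => by
    rw [schurKernel, sub_zero, add_zero, div_self (hy i)]
  have h := one_add_prod_schurKernel hn hinj (t := 0) fun i => by rw [add_zero]; exact hy i
  simp only [h0, Finset.prod_const_one, ← Finset.mul_sum, one_add_one_eq_two] at h
  exact (mul_eq_left₀ two_ne_zero).mp h.symm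

theorem schurProd_succAbove_eq_inv_mul (hy : ∀ i j, y i + y j ≠ 0) (hinj : Function.Injective y)
    (j : Fin (n + 1)) :
    (-1) ^ (j : ℕ) * schurProd (fun i => y (j.succAbove i)) =
      (∏ i, schurKernel (y j) (y (j.succAbove i)))⁻¹ * schurProd y := by
  have h0 : ∏ i, schurKernel (y j) (y (j.succAbove i)) ≠ 0 := Finset.prod_ne_zero_iff.mpr
    fun i _ => div_ne_zero (sub_ne_zero.mpr (hinj.ne (j.succAbove_ne i))) (hy _ _)
  rw [eq_inv_mul_iff_mul_eq₀ h0, mul_left_comm, ← schurProd_succAbove, ← mul_assoc, ← mul_pow,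
    neg_one_mul, neg_neg, one_pow, one_mul]

variable [NeZero (2 : K)]

theorem schurProd_eq_sum_of_even (hn : Even n) (hy : ∀ i j, y i + y j ≠ 0)
    (hinj : Function.Injective y) :
    schurProd y = ∑ j : Fin (n + 1), (-1) ^ (j : ℕ) * schurProd fun i => y (j.succAbove i) := by
  have hy0 : ∀ i, y i ≠ 0 := fun i h => hy i i (by rw [h, add_zero])
  rw [Finset.sum_congr rfl fun j _ => schurProd_succAbove_eq_inv_mul hy hinj j, ← Finset.sum_mul,
    sum_inv_prod_schurKernel hn hinj hy0, one_mul]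

theorem schurProd_eq_sum_schurKernel_mul_of_even {x : Fin (n + 2) → K} (hn : Even n)
    (hx : ∀ i j, x i + x j ≠ 0) (hinj : Function.Injective x) :
    schurProd x = ∑ j : Fin (n + 1), (-1) ^ (j : ℕ) * schurKernel (x 0) (x j.succ) *
      schurProd fun i => x (j.succAbove i).succ := by
  let y : Fin (n + 1) → K := fun i => x i.succ
  have hyinj : Function.Injective y := hinj.comp (Fin.succ_injective _)
  have hy0 : ∀ i, y i ≠ 0 := fun i h =>
    hx i.succ i.succ (by rw [show x i.succ = 0 from h, add_zero])
  have h := one_add_prod_schurKernel hn hyinj fun i => hx i.succ 0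
  simp only [add_mul, one_mul, Finset.sum_add_distrib, sum_inv_prod_schurKernel hn hyinj hy0,
    add_right_inj] at h
  rw [schurProd_succ, h, Finset.sum_mul]
  refine Finset.sum_congr rfl fun j _ => ?_
  rw [mul_assoc, ← schurProd_succAbove_eq_inv_mul (fun i j => hx _ _) hyinj j, mul_left_comm,
    ← mul_assoc]

end Expansion

end SchurProduct

section CauchyDeterminant

variable {K : Type*} [Field K]

theorem det_cauchy_succ {n : ℕ} (x y : Fin (n + 1) → K) (h : ∀ i j, x i + y j ≠ 0) :
    (Matrix.of fun i j => (x i + y j)⁻¹).det =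
      (x 0 + y 0)⁻¹ * (∏ i : Fin n, (x i.succ - x 0) / (x i.succ + y 0)) *
        (∏ j : Fin n, (y j.succ - y 0) / (x 0 + y j.succ)) *
          (Matrix.of fun i j : Fin n => (x i.succ + y j.succ)⁻¹).det := by
  let c : Fin (n + 1) → K := fun i => (x 0 + y 0) / (x i + y 0)
  let B : Matrix (Fin (n + 1)) (Fin (n + 1)) K := Matrix.of
    (Fin.cons (fun j => (x 0 + y j)⁻¹) fun i j => (x i.succ + y j)⁻¹ - c i.succ * (x 0 + y j)⁻¹)
  have hB : (Matrix.of fun i j => (x i + y j)⁻¹).det = B.det :=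
    Matrix.det_eq_of_forall_row_eq_smul_add_const (Fin.cons 0 fun i => c i.succ) 0 rfl
      (Fin.cases (by simp [B]) (by simp [B]))
  have hminor : B.submatrix Fin.succ Fin.succ = Matrix.of fun i j =>
      (x i.succ - x 0) / (x i.succ + y 0) *
        ((y j.succ - y 0) / (x 0 + y j.succ) * (x i.succ + y j.succ)⁻¹) := by
    ext i j
    have := h i.succ j.succ
    have := h 0 j.succ
    have := h i.succ 0
    simp only [B, c, Matrix.of_apply, Matrix.submatrix_apply, Fin.cons_succ]
    field_simp
    ring
  rw [hB, Matrix.det_succ_column_zero, Finset.sum_eq_single 0]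
  · rw [Fin.succAbove_zero, hminor, Fin.val_zero, pow_zero, one_mul, mul_assoc, mul_assoc]
    congr 1
    rw [← Matrix.det_mul_row, ← Matrix.det_mul_column]
    rfl
  · intro i _ hi
    obtain ⟨i, rfl⟩ := Fin.exists_succ_eq.mpr hi
    have h0 : B i.succ 0 = 0 := by
      simp only [B, c, Matrix.of_apply, Fin.cons_succ]
      rw [div_mul_eq_mul_div, mul_inv_cancel₀ (h 0 0), one_div, sub_self]
    rw [h0, mul_zero, zero_mul]
  · simp

theorem det_cauchy {n : ℕ} (x y : Fin n → K) (h : ∀ i j, x i + y j ≠ 0) :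
    (Matrix.of fun i j => (x i + y j)⁻¹).det =
      (Matrix.vandermonde x).det * (Matrix.vandermonde y).det / ∏ i, ∏ j, (x i + y j) := by
  induction n with
  | zero => simp
  | succ n ih =>
    rw [det_cauchy_succ x y h, ih (fun i => x i.succ) (fun i => y i.succ) fun i j => h _ _]
    simp only [Matrix.det_vandermonde, Fin.prod_univ_succ (n := n), Fin.prod_Ioi_zero,
      Fin.prod_Ioi_succ, Finset.prod_mul_distrib, Finset.prod_inv_distrib, div_eq_mul_inv, mul_inv]
    ring

theorem det_one_add_schurKernel {n : ℕ} {x y : Fin n → K} (h : ∀ i j, y j + x i ≠ 0) :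
    (Matrix.of fun i j => 1 + schurKernel (x i) (y j)).det =
      2 ^ n * (∏ j, y j) * ((Matrix.vandermonde x).det * (Matrix.vandermonde y).det /
        ∏ i, ∏ j, (x i + y j)) := by
  rw [← det_cauchy x y fun i j => add_comm (y j) _ ▸ h i j]
  have hentry : ∀ i j, 1 + schurKernel (x i) (y j) = 2 * y j * (x i + y j)⁻¹ := fun i j => by
    rw [one_add_schurKernel (h i j), add_comm, div_eq_mul_inv]
  simp only [hentry]
  rw [← Fin.prod_const, ← Finset.prod_mul_distrib, ← Matrix.det_mul_row]
  rfl

end CauchyDeterminant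

section PiMeasure

variable {X Y ι : Type*} [MeasurableSpace X] [MeasurableSpace Y] [Fintype ι]
  {μ : Measure X} [SigmaFinite μ] {ν : Measure Y} [SigmaFinite ν]

theorem measurePreserving_pi_comp_perm (μ : Measure X) [SigmaFinite μ] (σ : Equiv.Perm ι) :
    MeasurePreserving (MeasurableEquiv.arrowCongr' σ.symm (MeasurableEquiv.refl X))
      (Measure.pi fun _ : ι => μ) (Measure.pi fun _ : ι => μ) :=
  measurePreserving_arrowCongr' (fun _ => μ) (fun _ => μ) σ.symm (MeasurableEquiv.refl X)
    fun _ => MeasurePreserving.id μ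

theorem measurePreserving_prod_pi_comp_perm (μ : Measure X) [SigmaFinite μ]
    (ν : Measure Y) [SigmaFinite ν] (σ τ : Equiv.Perm ι) :
    MeasurePreserving (MeasurableEquiv.prodCongr
      (MeasurableEquiv.arrowCongr' σ.symm (MeasurableEquiv.refl X))
      (MeasurableEquiv.arrowCongr' τ.symm (MeasurableEquiv.refl Y)))
      ((Measure.pi fun _ => μ).prod (Measure.pi fun _ => ν))
      ((Measure.pi fun _ => μ).prod (Measure.pi fun _ => ν)) :=
  (measurePreserving_pi_comp_perm μ σ).prod (measurePreserving_pi_comp_perm ν τ)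

theorem measurePreserving_pi_succAbove (μ : Measure X) [SigmaFinite μ] {n : ℕ} (j : Fin (n + 1)) :
    MeasurePreserving (fun x : Fin (n + 1) → X => (x j, fun i => x (j.succAbove i)))
      (Measure.pi fun _ => μ) (μ.prod (Measure.pi fun _ => μ)) :=
  measurePreserving_piFinSuccAbove (fun _ => μ) j

theorem measurePreserving_pi_zero_succ_succAbove (μ : Measure X) [SigmaFinite μ] {n : ℕ}
    (j : Fin (n + 1)) :
    MeasurePreserving
      (fun x : Fin (n + 2) → X => ((x 0, x j.succ), fun i => x (j.succAbove i).succ))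
      (Measure.pi fun _ => μ) ((μ.prod μ).prod (Measure.pi fun _ => μ)) :=
  ((measurePreserving_prodAssoc μ μ _).symm.comp
    ((MeasurePreserving.id μ).prod (measurePreserving_pi_succAbove μ j))).comp
      (measurePreserving_pi_succAbove μ 0)

theorem ae_pi_injective [MeasurableEq X] [NullSingletonClass μ] (n : ℕ) :
    ∀ᵐ x ∂Measure.pi fun _ : Fin n => μ, Function.Injective x := by
  cases n with
  | zero => exact .of_forall fun x => Function.injective_of_subsingleton x
  | succ n =>
    have hne : ∀ (i : Fin (n + 1)) (k : Fin n),
        ∀ᵐ x ∂Measure.pi fun _ : Fin (n + 1) => μ, x i ≠ x (i.succAbove k) := fun i k => by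
      refine (measurePreserving_pi_succAbove μ i).quasiMeasurePreserving.ae
        (p := fun p => p.1 ≠ p.2 k) ?_
      exact (Measure.ae_prod_iff_ae_ae (measurableSet_eq_fun measurable_fst
        ((measurable_pi_apply k).comp measurable_snd)).compl).mpr
          (.of_forall fun a => (Measure.ae_eval_ne (fun _ => μ) k a).mono fun _ => Ne.symm)
    filter_upwards [ae_all_iff.mpr fun i => ae_all_iff.mpr (hne i)] with x hx i j hij
    by_contra hne
    obtain ⟨k, rfl⟩ := Fin.exists_succAbove_eq (Ne.symm hne)
    exact hx i k hij

theorem integral_sum_mul_of_measurePreserving {Ω J : Type*} [MeasurableSpace Ω] [Fintype J]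
    {P : Measure Ω} (c : J → ℂ) {e : J → Ω → X × Y}
    (he : ∀ j, MeasurePreserving (e j) P (μ.prod ν)) {φ : J → X → ℂ} {ψ : J → Y → ℂ}
    (hφ : ∀ j, Integrable (φ j) μ) (hψ : ∀ j, Integrable (ψ j) ν) :
    ∫ ω, ∑ j, c j * (φ j (e j ω).1 * ψ j (e j ω).2) ∂P =
      ∑ j, c j * ((∫ x, φ j x ∂μ) * ∫ y, ψ j y ∂ν) := by
  have hint : ∀ j, Integrable (fun p : X × Y => φ j p.1 * ψ j p.2) (μ.prod ν) := fun j =>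
    (hφ j).mul_prod (hψ j)
  have hcomp : ∀ j, Integrable (fun ω => c j * (φ j (e j ω).1 * ψ j (e j ω).2)) P := fun j =>
    ((he j).integrable_comp_of_integrable (hint j)).const_mul _
  rw [integral_finsetSum _ fun j _ => hcomp j]
  refine Finset.sum_congr rfl fun j _ => ?_
  rw [integral_const_mul, ← integral_prod_mul, ← (he j).map_eq, integral_map (he j).aemeasurable
    ((he j).map_eq ▸ (hint j).aestronglyMeasurable)]

section Andreief

variable {q : ι → ι → X × Y → ℂ}

theorem measurePreserving_pi_prodMk_comp_perm (σ : Equiv.Perm ι) :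
    MeasurePreserving (fun (p : (ι → X) × (ι → Y)) i => (p.1 (σ i), p.2 i))
      ((Measure.pi fun _ => μ).prod (Measure.pi fun _ => ν))
      (Measure.pi fun _ => μ.prod ν) :=
  (measurePreserving_arrowProdEquivProdArrow X Y ι (fun _ => μ) fun _ => ν).symm.comp
    ((measurePreserving_pi_comp_perm μ σ).prod (MeasurePreserving.id _))

theorem integrable_prod_comp_perm (hq : ∀ i j, Integrable (q i j) (μ.prod ν))
    (σ : Equiv.Perm ι) :
    Integrable (fun p : (ι → X) × (ι → Y) => ∏ i, q (σ i) i (p.1 (σ i), p.2 i))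
      ((Measure.pi fun _ => μ).prod (Measure.pi fun _ => ν)) :=
  (measurePreserving_pi_prodMk_comp_perm σ).integrable_comp_of_integrable
    (Integrable.fintype_prod fun i => hq (σ i) i)

theorem integral_prod_comp_perm (hq : ∀ i j, Integrable (q i j) (μ.prod ν))
    (σ : Equiv.Perm ι) :
    ∫ p : (ι → X) × (ι → Y), ∏ i, q (σ i) i (p.1 (σ i), p.2 i)
        ∂(Measure.pi fun _ => μ).prod (Measure.pi fun _ => ν) =
      ∏ i, ∫ r, q (σ i) i r ∂μ.prod ν := by
  have he := measurePreserving_pi_prodMk_comp_perm (μ := μ) (ν := ν) σ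
  rw [← integral_fintype_prod_eq_prod, ← he.map_eq, integral_map he.aemeasurable
    (he.map_eq ▸ (Integrable.fintype_prod fun i => hq (σ i) i).aestronglyMeasurable)]

variable [DecidableEq ι]

theorem integrable_det_prod (hq : ∀ i j, Integrable (q i j) (μ.prod ν)) :
    Integrable (fun p : (ι → X) × (ι → Y) => (Matrix.of fun i j => q i j (p.1 i, p.2 j)).det)
      ((Measure.pi fun _ => μ).prod (Measure.pi fun _ => ν)) := by
  simp only [Matrix.det_apply', Matrix.of_apply]
  exact integrable_finsetSum _ fun σ _ => (integrable_prod_comp_perm hq σ).const_mul _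

theorem integral_det_prod (hq : ∀ i j, Integrable (q i j) (μ.prod ν)) :
    ∫ p : (ι → X) × (ι → Y), (Matrix.of fun i j => q i j (p.1 i, p.2 j)).det
        ∂(Measure.pi fun _ => μ).prod (Measure.pi fun _ => ν) =
      (Matrix.of fun i j => ∫ r, q i j r ∂μ.prod ν).det := by
  simp only [Matrix.det_apply', Matrix.of_apply]
  rw [integral_finsetSum _ fun σ _ => (integrable_prod_comp_perm hq σ).const_mul _]
  simp only [integral_const_mul, integral_prod_comp_perm hq]

end Andreief

end PiMeasure

section SlaterDeterminant

variable {X Y ι R : Type*} [Fintype ι] [DecidableEq ι]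

section Algebra

variable [CommRing R] (f : ι → X → R) (x : ι → X)

/-- The Slater determinant `det (f i (x j))` of the functions `f i` at the points `x j`. -/
def slaterDet : R :=
  (Matrix.of fun i j => f i (x j)).det

theorem slaterDet_eq_zero_of_eq {i j : ι} (hij : i ≠ j) (hf : f i = f j) : slaterDet f x = 0 :=
  Matrix.det_zero_of_row_eq hij (funext fun k => congrFun hf (x k))

variable {f x}

theorem mul_slaterDet_eq_sum {S : (ι → X) → R}
    (hS : ∀ σ : Equiv.Perm ι, S (x ∘ σ) = (Equiv.Perm.sign σ : ℤ) * S x) :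
    S x * slaterDet f x = ∑ σ : Equiv.Perm ι, S (x ∘ σ) * ∏ i, f i ((x ∘ σ) i) := by
  rw [slaterDet, ← Matrix.det_transpose, Matrix.det_apply', Finset.mul_sum]
  refine Finset.sum_congr rfl fun σ _ => ?_
  rw [hS, mul_left_comm, mul_assoc]
  rfl

theorem det_mul_slaterDet_mul_slaterDet_eq_sum (q : X → Y → R) (g : ι → Y → R) (y : ι → Y) :
    (Matrix.of fun i j => q (x i) (y j)).det * (slaterDet f x * slaterDet g y) =
      ∑ σ : Equiv.Perm ι, ∑ τ : Equiv.Perm ι, (Matrix.of fun i j =>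
        q (x (σ i)) (y (τ j)) * (f i (x (σ i)) * g j (y (τ j)))).det := by
  have hrow : ∀ (z : ι → Y) (σ : Equiv.Perm ι),
      (Matrix.of fun i j => q ((x ∘ σ) i) (z j)).det =
        (Equiv.Perm.sign σ : ℤ) * (Matrix.of fun i j => q (x i) (z j)).det := fun z σ =>
    Matrix.det_permute σ (Matrix.of fun i j => q (x i) (z j))
  have hcol : ∀ τ : Equiv.Perm ι,
      (Matrix.of fun i j => q (x i) ((y ∘ τ) j)).det =
        (Equiv.Perm.sign τ : ℤ) * (Matrix.of fun i j => q (x i) (y j)).det := fun τ =>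
    Matrix.det_permute' τ (Matrix.of fun i j => q (x i) (y j))
  rw [mul_comm (slaterDet f x), ← mul_assoc,
    mul_slaterDet_eq_sum (S := fun z => (Matrix.of fun i j => q (x i) (z j)).det) hcol,
    Finset.sum_mul, Finset.sum_comm]
  refine Finset.sum_congr rfl fun τ _ => ?_
  rw [mul_right_comm, mul_slaterDet_eq_sum
    (S := fun z => (Matrix.of fun i j => q (z i) ((y ∘ τ) j)).det) (hrow _), Finset.sum_mul]
  refine Finset.sum_congr rfl fun σ _ => ?_
  rw [mul_comm _ (∏ i, f i ((x ∘ σ) i)), ← Matrix.det_mul_column, mul_comm, ← Matrix.det_mul_row]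
  congr 1
  ext i j
  simp only [Matrix.of_apply, Function.comp_apply]
  ring

end Algebra

variable [MeasurableSpace X] [MeasurableSpace Y] {μ : Measure X} [SigmaFinite μ]
  {ν : Measure Y} [SigmaFinite ν] {f : ι → X → ℂ} {g : ι → Y → ℂ}

section OneSided

variable {S : (ι → X) → ℂ}

theorem integrable_mul_slaterDet
    (hS : ∀ (σ : Equiv.Perm ι) x, S (x ∘ σ) = (Equiv.Perm.sign σ : ℤ) * S x)
    (hint : Integrable (fun x => S x * ∏ i, f i (x i)) (Measure.pi fun _ => μ)) :
    Integrable (fun x => S x * slaterDet f x) (Measure.pi fun _ => μ) := by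
  simp only [mul_slaterDet_eq_sum (hS · _)]
  exact integrable_finsetSum _ fun σ _ =>
    (measurePreserving_pi_comp_perm μ σ).integrable_comp_of_integrable hint

theorem integral_mul_slaterDet
    (hS : ∀ (σ : Equiv.Perm ι) x, S (x ∘ σ) = (Equiv.Perm.sign σ : ℤ) * S x)
    (hint : Integrable (fun x => S x * ∏ i, f i (x i)) (Measure.pi fun _ => μ)) :
    ∫ x, S x * slaterDet f x ∂Measure.pi (fun _ => μ) =
      (Fintype.card ι).factorial * ∫ x, S x * ∏ i, f i (x i) ∂Measure.pi fun _ => μ := by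
  have hperm : ∀ σ : Equiv.Perm ι, Integrable (fun x => S (x ∘ σ) * ∏ i, f i ((x ∘ σ) i))
      (Measure.pi fun _ => μ) := fun σ =>
    (measurePreserving_pi_comp_perm μ σ).integrable_comp_of_integrable hint
  simp only [mul_slaterDet_eq_sum (hS · _)]
  rw [integral_finsetSum _ fun σ _ => hperm σ, ← Fintype.card_perm, ← nsmul_eq_mul]
  exact Finset.sum_eq_card_nsmul fun σ _ =>
    (measurePreserving_pi_comp_perm μ σ).integral_comp' fun x => S x * ∏ i, f i (x i)

end OneSided

section TwoSided

variable {q : X → Y → ℂ}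

variable (hint : ∀ i j, Integrable (fun r : X × Y => q r.1 r.2 * (f i r.1 * g j r.2)) (μ.prod ν))
include hint

theorem integrable_det_mul_slaterDet_mul_slaterDet :
    Integrable (fun p : (ι → X) × (ι → Y) =>
        (Matrix.of fun i j => q (p.1 i) (p.2 j)).det * (slaterDet f p.1 * slaterDet g p.2))
      ((Measure.pi fun _ => μ).prod (Measure.pi fun _ => ν)) := by
  simp only [det_mul_slaterDet_mul_slaterDet_eq_sum]
  exact integrable_finsetSum _ fun σ _ => integrable_finsetSum _ fun τ _ =>
    (measurePreserving_prod_pi_comp_perm μ ν σ τ).integrable_comp_of_integrable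
      (integrable_det_prod hint)

theorem integral_det_mul_slaterDet_mul_slaterDet :
    ∫ p : (ι → X) × (ι → Y),
        (Matrix.of fun i j => q (p.1 i) (p.2 j)).det * (slaterDet f p.1 * slaterDet g p.2)
        ∂(Measure.pi fun _ => μ).prod (Measure.pi fun _ => ν) =
      (Fintype.card ι).factorial ^ 2 *
        (Matrix.of fun i j => ∫ r : X × Y, q r.1 r.2 * (f i r.1 * g j r.2) ∂μ.prod ν).det := by
  have hperm : ∀ σ τ : Equiv.Perm ι, Integrable (fun p : (ι → X) × (ι → Y) => (Matrix.of fun i j =>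
      q (p.1 (σ i)) (p.2 (τ j)) * (f i (p.1 (σ i)) * g j (p.2 (τ j)))).det)
      ((Measure.pi fun _ => μ).prod (Measure.pi fun _ => ν)) := fun σ τ =>
    (measurePreserving_prod_pi_comp_perm μ ν σ τ).integrable_comp_of_integrable
      (integrable_det_prod hint)
  simp only [det_mul_slaterDet_mul_slaterDet_eq_sum]
  rw [integral_finsetSum _ fun σ _ => integrable_finsetSum _ fun τ _ => hperm σ τ,
    ← integral_det_prod hint, ← Fintype.card_perm, sq, mul_assoc, ← nsmul_eq_mul, ← nsmul_eq_mul]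
  refine Finset.sum_eq_card_nsmul fun σ _ => ?_
  rw [integral_finsetSum _ fun τ _ => hperm σ τ]
  exact Finset.sum_eq_card_nsmul fun τ _ =>
    (measurePreserving_prod_pi_comp_perm μ ν σ τ).integral_comp' fun p : (ι → X) × (ι → Y) =>
      (Matrix.of fun i j => q (p.1 i) (p.2 j) * (f i (p.1 i) * g j (p.2 j))).det

end TwoSided

end SlaterDeterminant

section IntegralForms

variable {X ι : Type*} [MeasurableSpace X] {μ : Measure X}

/-- The space of integrable functions, not identified up to equality almost everywhere, so that
they can be evaluated at points. -/
def integrableSubmodule (μ : Measure X) : Submodule ℂ (X → ℂ) where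
  carrier := {f | Integrable f μ}
  zero_mem' := integrable_zero _ _ _
  add_mem' := Integrable.add
  smul_mem' c _ hf := hf.smul c

/-- Integration as a linear form on integrable functions. -/
noncomputable def integralForm (μ : Measure X) : integrableSubmodule μ →ₗ[ℂ] ℂ where
  toFun f := ∫ x, f.1 x ∂μ
  map_add' f g := integral_add f.2 g.2
  map_smul' c _ := integral_smul c _

/-- The bilinear form `(f, g) ↦ ∫ q (x, y) f x g y` of a kernel `q`. -/
noncomputable def kernelForm (q : X × X → ℂ) (hq : ∀ f g : integrableSubmodule μ,
    Integrable (fun p : X × X => q p * (f.1 p.1 * g.1 p.2)) (μ.prod μ)) :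
    integrableSubmodule μ →ₗ[ℂ] integrableSubmodule μ →ₗ[ℂ] ℂ :=
  LinearMap.mk₂ ℂ (fun f g => ∫ p : X × X, q p * (f.1 p.1 * g.1 p.2) ∂μ.prod μ)
    (fun f f' g => by
      simp only [Submodule.coe_add, Pi.add_apply, add_mul, mul_add]
      exact integral_add (hq f g) (hq f' g))
    (fun c f g => by
      simp only [Submodule.coe_smul, Pi.smul_apply, smul_mul_assoc, mul_smul_comm]
      exact integral_smul _ _)
    (fun f g g' => by
      simp only [Submodule.coe_add, Pi.add_apply, mul_add]
      exact integral_add (hq f g) (hq f g'))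
    (fun c f g => by
      simp only [Submodule.coe_smul, Pi.smul_apply, mul_smul_comm]
      exact integral_smul _ _)

theorem kernelForm_isAlt [SFinite μ] {q : X × X → ℂ} (hq : ∀ f g : integrableSubmodule μ,
    Integrable (fun p : X × X => q p * (f.1 p.1 * g.1 p.2)) (μ.prod μ))
    (hswap : ∀ p, q p.swap = -q p) : (kernelForm q hq).IsAlt := by
  intro f
  have h : ∫ p : X × X, -(q p * (f.1 p.1 * f.1 p.2)) ∂μ.prod μ =
      ∫ p : X × X, q p * (f.1 p.1 * f.1 p.2) ∂μ.prod μ := by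
    rw [← integral_prod_swap]
    congr 1
    ext p
    rw [hswap, Prod.fst_swap, Prod.snd_swap]
    ring
  rw [integral_neg] at h
  exact self_eq_neg.mp h.symm

/-- The product `∏ i, f i (x i)` of the values of functions, as a multilinear map. -/
noncomputable def prodEvalMultilinear [Fintype ι] (μ : Measure X) (x : ι → X) :
    MultilinearMap ℂ (fun _ : ι => integrableSubmodule μ) ℂ :=
  (MultilinearMap.mkPiAlgebra ℂ ι ℂ).compLinearMap fun i =>
    LinearMap.proj (x i) ∘ₗ (integrableSubmodule μ).subtype

variable [Fintype ι] [DecidableEq ι] [SigmaFinite μ]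

/-- The alternating form `(f i) ↦ ∫ S x ∏ i, f i (x i)` of an antisymmetric function `S`. -/
noncomputable def antisymmForm (S : (ι → X) → ℂ)
    (hS : ∀ (σ : Equiv.Perm ι) x, S (x ∘ σ) = (Equiv.Perm.sign σ : ℤ) * S x)
    (hint : ∀ f : ι → integrableSubmodule μ,
      Integrable (fun x => S x * ∏ i, (f i).1 (x i)) (Measure.pi fun _ => μ)) :
    integrableSubmodule μ [⋀^ι]→ₗ[ℂ] ℂ where
  toFun f := ∫ x, S x * ∏ i, (f i).1 (x i) ∂Measure.pi fun _ => μ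
  map_update_add' f i g g' := by
    rw [← integral_add (hint _) (hint _)]
    refine integral_congr_ae (.of_forall fun x => ?_)
    exact (congrArg (S x * ·) ((prodEvalMultilinear μ x).map_update_add f i g g')).trans
      (mul_add _ _ _)
  map_update_smul' f i c g := by
    rw [← integral_smul]
    refine integral_congr_ae (.of_forall fun x => ?_)
    exact (congrArg (S x * ·) ((prodEvalMultilinear μ x).map_update_smul f i c g)).trans
      (mul_smul_comm _ _ _)
  map_eq_zero_of_eq' f i j hf hij := by
    have h := integral_mul_slaterDet hS (hint f)
    simp only [slaterDet_eq_zero_of_eq (fun i => (f i).1) _ hij (congrArg Subtype.val hf), mul_zero,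
      integral_zero] at h
    exact (mul_eq_zero.mp h.symm).resolve_left (mod_cast Nat.factorial_ne_zero _)

end IntegralForms

section SchurForms

theorem abs_schurKernel_le {a b : ℝ} (ha : 0 < a) (hb : 0 < b) : |schurKernel a b| ≤ 1 := by
  rw [schurKernel, abs_div, abs_of_pos (add_pos hb ha), div_le_one (add_pos hb ha), abs_le]
  constructor <;> linarith

theorem abs_schurProd_le {n : ℕ} {x : Fin n → ℝ} (hx : ∀ i, 0 < x i) : |schurProd x| ≤ 1 := by
  simp only [schurProd, Finset.abs_prod]
  exact Finset.prod_le_one (fun _ _ => Finset.prod_nonneg fun _ _ => abs_nonneg _) fun i _ =>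
    Finset.prod_le_one (fun _ _ => abs_nonneg _) fun j _ => abs_schurKernel_le (hx i) (hx j)

theorem measurable_schurKernel : Measurable fun p : ℝ × ℝ => schurKernel p.1 p.2 := by
  unfold schurKernel
  fun_prop

theorem measurable_schurProd (n : ℕ) : Measurable (schurProd : (Fin n → ℝ) → ℝ) := by
  unfold schurProd schurKernel
  fun_prop

variable {μ : Measure ℝ}

theorem integrable_schurKernel_mul (hμ : ∀ᵐ x ∂μ, 0 < x) {F : ℝ × ℝ → ℂ}
    (hF : Integrable F (μ.prod μ)) :
    Integrable (fun p => ((schurKernel p.1 p.2 : ℝ) : ℂ) * F p) (μ.prod μ) := by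
  refine hF.bdd_mul (c := 1)
    (Complex.measurable_ofReal.comp measurable_schurKernel).aestronglyMeasurable ?_
  filter_upwards [Measure.quasiMeasurePreserving_fst.ae hμ,
    Measure.quasiMeasurePreserving_snd.ae hμ] with p hp₁ hp₂
  rw [Complex.norm_real, Real.norm_eq_abs]
  exact abs_schurKernel_le hp₁ hp₂

theorem integrable_schurKernel_mul_mul (hμ : ∀ᵐ x ∂μ, 0 < x) (f g : integrableSubmodule μ) :
    Integrable (fun p : ℝ × ℝ => ((schurKernel p.1 p.2 : ℝ) : ℂ) * (f.1 p.1 * g.1 p.2))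
      (μ.prod μ) :=
  integrable_schurKernel_mul hμ (f.2.mul_prod g.2)

theorem ofReal_one_add_mul (s : ℝ) (z : ℂ) : ((1 + s : ℝ) : ℂ) * z = s * z + z := by
  rw [Complex.ofReal_add, Complex.ofReal_one, add_mul, one_mul, add_comm]

theorem integrable_one_add_schurKernel_mul_mul (hμ : ∀ᵐ x ∂μ, 0 < x)
    (f g : integrableSubmodule μ) :
    Integrable (fun p : ℝ × ℝ => ((1 + schurKernel p.1 p.2 : ℝ) : ℂ) * (f.1 p.1 * g.1 p.2))
      (μ.prod μ) := by
  simp only [ofReal_one_add_mul]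
  exact (integrable_schurKernel_mul_mul hμ f g).add (f.2.mul_prod g.2)

variable [SigmaFinite μ]

theorem ae_pi_pos (hμ : ∀ᵐ x ∂μ, 0 < x) (n : ℕ) :
    ∀ᵐ x ∂Measure.pi fun _ : Fin n => μ, ∀ i, 0 < x i :=
  ae_all_iff.mpr fun i => (Measure.quasiMeasurePreserving_eval _ i).ae hμ

theorem integrable_schurProd_mul (hμ : ∀ᵐ x ∂μ, 0 < x) {n : ℕ} {F : (Fin n → ℝ) → ℂ}
    (hF : Integrable F (Measure.pi fun _ => μ)) :
    Integrable (fun x => ((schurProd x : ℝ) : ℂ) * F x) (Measure.pi fun _ => μ) := by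
  refine hF.bdd_mul (c := 1)
    (Complex.measurable_ofReal.comp (measurable_schurProd n)).aestronglyMeasurable ?_
  filter_upwards [ae_pi_pos hμ n] with x hx
  rw [Complex.norm_real, Real.norm_eq_abs]
  exact abs_schurProd_le hx

theorem ofReal_schurProd_comp_perm {n : ℕ} (σ : Equiv.Perm (Fin n)) (x : Fin n → ℝ) :
    ((schurProd (x ∘ σ) : ℝ) : ℂ) = (Equiv.Perm.sign σ : ℤ) * (schurProd x : ℝ) := by
  rw [schurProd_comp_perm]
  push_cast
  rfl

theorem integrable_schurProd_mul_prod (hμ : ∀ᵐ x ∂μ, 0 < x) {n : ℕ}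
    (f : Fin n → integrableSubmodule μ) :
    Integrable (fun x => ((schurProd x : ℝ) : ℂ) * ∏ i, (f i).1 (x i)) (Measure.pi fun _ => μ) :=
  integrable_schurProd_mul hμ (Integrable.fintype_prod fun i => (f i).2)

/-- The bilinear form `(f, g) ↦ ∫ (y - x) / (y + x) f x g y`. -/
noncomputable def schurForm (hμ : ∀ᵐ x ∂μ, 0 < x) :
    integrableSubmodule μ →ₗ[ℂ] integrableSubmodule μ →ₗ[ℂ] ℂ :=
  kernelForm (fun p => (schurKernel p.1 p.2 : ℝ)) (integrable_schurKernel_mul_mul hμ)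

theorem schurForm_isAlt (hμ : ∀ᵐ x ∂μ, 0 < x) : (schurForm hμ).IsAlt :=
  kernelForm_isAlt _ fun p => by
    rw [Prod.fst_swap, Prod.snd_swap, schurKernel_swap, Complex.ofReal_neg]

/-- The alternating form `(f i) ↦ ∫ ∏_{i < j} (x_j - x_i) / (x_j + x_i) ∏ i, f i (x i)`. -/
noncomputable def schurAlternatingForm (hμ : ∀ᵐ x ∂μ, 0 < x) (n : ℕ) :
    integrableSubmodule μ [⋀^Fin n]→ₗ[ℂ] ℂ :=
  antisymmForm (fun x => (schurProd x : ℝ)) ofReal_schurProd_comp_perm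
    (integrable_schurProd_mul_prod hμ)

theorem integral_one_add_schurKernel_mul_mul (hμ : ∀ᵐ x ∂μ, 0 < x)
    (f g : integrableSubmodule μ) :
    ∫ p : ℝ × ℝ, ((1 + schurKernel p.1 p.2 : ℝ) : ℂ) * (f.1 p.1 * g.1 p.2) ∂μ.prod μ =
      (schurForm hμ + (integralForm μ).smulRight (integralForm μ)) f g := by
  simp only [ofReal_one_add_mul]
  rw [integral_add (integrable_schurKernel_mul_mul hμ f g) (f.2.mul_prod g.2), integral_prod_mul]
  rfl

variable [NullSingletonClass μ]

theorem schurAlternatingForm_add_one_of_even (hμ : ∀ᵐ x ∂μ, 0 < x) {n : ℕ} (hn : Even n)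
    (f : Fin (n + 1) → integrableSubmodule μ) :
    schurAlternatingForm hμ (n + 1) f = ∑ j : Fin (n + 1), (-1) ^ (j : ℕ) *
      (integralForm μ (f j) * schurAlternatingForm hμ n fun i => f (j.succAbove i)) := by
  refine Eq.trans (integral_congr_ae ?_) (integral_sum_mul_of_measurePreserving _
    (measurePreserving_pi_succAbove μ) (fun j => (f j).2)
    fun j => integrable_schurProd_mul_prod hμ fun i => f (j.succAbove i))
  filter_upwards [ae_pi_pos hμ (n + 1), ae_pi_injective (n + 1)] with x hx hinj
  rw [schurProd_eq_sum_of_even hn (fun i j => (add_pos (hx i) (hx j)).ne') hinj]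
  push_cast
  rw [Finset.sum_mul]
  refine Finset.sum_congr rfl fun j _ => ?_
  rw [Fin.prod_univ_succAbove _ j]
  ring

theorem schurAlternatingForm_add_two_of_even (hμ : ∀ᵐ x ∂μ, 0 < x) {n : ℕ} (hn : Even n)
    (f : Fin (n + 2) → integrableSubmodule μ) :
    schurAlternatingForm hμ (n + 2) f = ∑ j : Fin (n + 1), (-1) ^ (j : ℕ) *
      (schurForm hμ (f 0) (f j.succ) *
        schurAlternatingForm hμ n fun i => f (j.succAbove i).succ) := by
  refine Eq.trans (integral_congr_ae ?_) (integral_sum_mul_of_measurePreserving _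
    (measurePreserving_pi_zero_succ_succAbove μ)
    (fun j => integrable_schurKernel_mul_mul hμ (f 0) (f j.succ))
    fun j => integrable_schurProd_mul_prod hμ fun i => f (j.succAbove i).succ)
  filter_upwards [ae_pi_pos hμ (n + 2), ae_pi_injective (n + 2)] with x hx hinj
  rw [schurProd_eq_sum_schurKernel_mul_of_even hn (fun i j => (add_pos (hx i) (hx j)).ne') hinj]
  push_cast
  rw [Finset.sum_mul]
  refine Finset.sum_congr rfl fun j _ => ?_
  rw [Fin.prod_univ_succ, Fin.prod_univ_succAbove _ j]
  ring

theorem isBorderedPfaffian_schurAlternatingForm (hμ : ∀ᵐ x ∂μ, 0 < x) :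
    IsBorderedPfaffian (schurForm hμ) (integralForm μ) (schurAlternatingForm hμ) where
  zero f := by
    change ∫ x : Fin 0 → ℝ, ((schurProd x : ℝ) : ℂ) * ∏ i, (f i).1 (x i)
      ∂Measure.pi (fun _ => μ) = 1
    simp [schurProd, Measure.real]
  even_add_two n hn f := by
    simp only [schurAlternatingForm_add_two_of_even hμ hn, mul_assoc]
  even_add_one n hn f := by
    simp only [schurAlternatingForm_add_one_of_even hμ hn, mul_assoc]

theorem sq_integral_schurProd_mul_slaterDet (hμ : ∀ᵐ x ∂μ, 0 < x) {n : ℕ} {f : Fin n → ℝ → ℂ}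
    (hf : ∀ i, Integrable (f i) μ) :
    (∫ x, ((schurProd x : ℝ) : ℂ) * slaterDet f x ∂Measure.pi fun _ => μ) ^ 2 =
      ∫ p : (Fin n → ℝ) × (Fin n → ℝ),
        (Matrix.of fun i j => ((1 + schurKernel (p.1 i) (p.2 j) : ℝ) : ℂ)).det *
          (slaterDet f p.1 * slaterDet f p.2)
        ∂(Measure.pi fun _ => μ).prod (Measure.pi fun _ => μ) := by
  let F : Fin n → integrableSubmodule μ := fun i => ⟨f i, hf i⟩
  have hgram : (Matrix.of fun i j => ∫ p : ℝ × ℝ, ((1 + schurKernel p.1 p.2 : ℝ) : ℂ) *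
      (f i p.1 * f j p.2) ∂μ.prod μ) =
        bilinGram (schurForm hμ + (integralForm μ).smulRight (integralForm μ)) F :=
    Matrix.ext fun i j => integral_one_add_schurKernel_mul_mul hμ (F i) (F j)
  rw [integral_mul_slaterDet ofReal_schurProd_comp_perm (integrable_schurProd_mul_prod hμ F),
    integral_det_mul_slaterDet_mul_slaterDet (q := fun s t => ((1 + schurKernel s t : ℝ) : ℂ))
      fun i j => integrable_one_add_schurKernel_mul_mul hμ (F i) (F j),
    hgram, mul_pow, ← (isBorderedPfaffian_schurAlternatingForm hμ).sq_eq_det (schurForm_isAlt hμ)]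
  rfl

end SchurForms

section Models

variable {k l : ℕ} {θ a : ℝ} {κ : Fin k → ℂ} {lam : Fin l → ℂ}

theorem charWeight_add (b : ℝ) {x : ℝ} (hx : 0 < x) :
    charWeight θ (a + b) κ lam x = ((x ^ b : ℝ) : ℂ) * charWeight θ a κ lam x := by
  rw [charWeight, charWeight, Real.rpow_add hx]
  push_cast
  ring

/-- The functions `(x ^ θ) ^ j` times the weight; both ensembles are built from their Slater
determinants. -/
noncomputable def weightedPower (θ a : ℝ) (κ : Fin k → ℂ) (lam : Fin l → ℂ) (j : ℕ) (x : ℝ) : ℂ :=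
  (((x ^ θ) ^ j : ℝ) : ℂ) * charWeight θ a κ lam x

section Integrands

variable {N : ℕ}

theorem slaterDet_weightedPower (x : Fin N → ℝ) :
    slaterDet (fun j : Fin N => weightedPower θ a κ lam j) x =
      (vandermondeProd (fun i => x i ^ θ) : ℂ) * ∏ j, charWeight θ a κ lam (x j) := by
  have hvandermonde : (vandermondeProd (fun i => x i ^ θ) : ℂ) =
      (Matrix.of fun i j : Fin N => (((x j ^ θ) ^ (i : ℕ) : ℝ) : ℂ)).det := by
    rw [vandermondeProd, ← Matrix.det_vandermonde, ← Matrix.det_transpose]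
    exact RingHom.map_det Complex.ofRealHom _
  rw [hvandermonde, mul_comm, ← Matrix.det_mul_row]
  exact congrArg Matrix.det (Matrix.ext fun i j => mul_comm _ _)

theorem buresIntegrand_eq_schurProd_mul_slaterDet (x : Fin N → ℝ) :
    buresIntegrand θ a κ lam x =
      ((schurProd x : ℝ) : ℂ) * slaterDet (fun j : Fin N => weightedPower θ a κ lam j) x := by
  rw [slaterDet_weightedPower, ← mul_assoc, ← Complex.ofReal_mul]
  simp only [buresIntegrand, schurProd, schurKernel, vandermondeProd, Finset.prod_mul_distrib]

theorem two_pow_mul_cauchyIntegrand_eq {p : (Fin N → ℝ) × (Fin N → ℝ)} (hp₁ : ∀ i, 0 < p.1 i)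
    (hp₂ : ∀ i, 0 < p.2 i) :
    2 ^ N * cauchyIntegrand θ a (a + 1) κ lam κ lam p =
      (Matrix.of fun i j => ((1 + schurKernel (p.1 i) (p.2 j) : ℝ) : ℂ)).det *
        (slaterDet (fun j : Fin N => weightedPower θ a κ lam j) p.1 *
          slaterDet (fun j : Fin N => weightedPower θ a κ lam j) p.2) := by
  have hdet : (Matrix.of fun i j => ((1 + schurKernel (p.1 i) (p.2 j) : ℝ) : ℂ)).det =
      ((2 ^ N * (∏ j, p.2 j) * (vandermondeProd p.1 * vandermondeProd p.2 /
        ∏ i, ∏ j, (p.1 i + p.2 j)) : ℝ) : ℂ) := by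
    have h := det_one_add_schurKernel fun i j => (add_pos (hp₂ j) (hp₁ i)).ne'
    rw [Matrix.det_vandermonde, Matrix.det_vandermonde] at h
    exact (RingHom.map_det Complex.ofRealHom _).symm.trans (congrArg _ h)
  have hweight : ∀ j, charWeight θ (a + 1) κ lam (p.2 j) = p.2 j * charWeight θ a κ lam (p.2 j) :=
    fun j => by rw [charWeight_add 1 (hp₂ j), Real.rpow_one]
  rw [hdet, slaterDet_weightedPower, slaterDet_weightedPower, cauchyIntegrand]
  simp only [hweight, Finset.prod_mul_distrib]
  push_cast
  ring

end Integrands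

section Convergence

theorem integrableOn_rpow_mul_exp_neg_mul_prod (hθ : 0 < θ) (s : Finset (Fin l)) {b : ℝ}
    (hb : -1 < b) :
    IntegrableOn (fun x : ℝ => ((x ^ b * Real.exp (-x) : ℝ) : ℂ) *
      ∏ i ∈ s, (((x ^ θ : ℝ) : ℂ) - lam i)) (Set.Ioi 0) := by
  induction s using Finset.induction_on generalizing b with
  | empty =>
    have h := Real.GammaIntegral_convergent (s := b + 1) (by linarith)
    simp only [add_sub_cancel_right, mul_comm (Real.exp _)] at h
    simp only [Finset.prod_empty, mul_one]
    exact Integrable.ofReal h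
  | insert i s hi ih =>
    refine ((ih (b := b + θ) (by linarith)).sub ((ih hb).const_mul (lam i))).congr ?_
    filter_upwards [ae_restrict_mem measurableSet_Ioi] with x hx
    rw [Finset.prod_insert hi, Pi.sub_apply, Real.rpow_add hx]
    push_cast
    ring

theorem exists_norm_inv_sub_le {z : ℂ} (hz : ∀ t : ℝ, 0 ≤ t → z ≠ (t : ℂ)) :
    ∃ C : ℝ, ∀ x : ℝ, 0 ≤ x → ‖((x : ℂ) - z)⁻¹‖ ≤ C := by
  have hclosed : IsClosed ((fun t : ℝ => (t : ℂ)) '' Set.Ici 0) :=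
    Complex.isometry_ofReal.isClosedEmbedding.isClosedMap _ isClosed_Ici
  have hz_notMem : z ∉ (fun t : ℝ => (t : ℂ)) '' Set.Ici 0 := by
    rintro ⟨t, ht, rfl⟩
    exact hz t ht rfl
  have hpos := (hclosed.notMem_iff_infDist_pos ⟨_, 0, Set.self_mem_Ici, rfl⟩).1 hz_notMem
  refine ⟨(Metric.infDist z ((fun t : ℝ => (t : ℂ)) '' Set.Ici 0))⁻¹, fun x hx => ?_⟩
  rw [norm_inv, ← dist_eq_norm, dist_comm]
  exact inv_anti₀ hpos (Metric.infDist_le_dist_of_mem ⟨x, hx, rfl⟩)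

theorem integrableOn_charWeight (hθ : 0 < θ) (ha : -1 < a)
    (hκ : ∀ i, ∀ t : ℝ, 0 ≤ t → κ i ≠ (t : ℂ)) :
    IntegrableOn (charWeight θ a κ lam) (Set.Ioi 0) := by
  choose C hC using fun i => exists_norm_inv_sub_le (hκ i)
  have hmeas : Measurable fun x : ℝ => ∏ i, ((x : ℂ) - κ i)⁻¹ := by fun_prop
  have hbound : ∀ᵐ x : ℝ ∂volume.restrict (Set.Ioi 0), ‖∏ i, ((x : ℂ) - κ i)⁻¹‖ ≤ ∏ i, C i := by
    filter_upwards [ae_restrict_mem measurableSet_Ioi] with x hx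
    rw [norm_prod]
    exact Finset.prod_le_prod (fun _ _ => norm_nonneg _) fun i _ => hC i x (le_of_lt hx)
  refine ((integrableOn_rpow_mul_exp_neg_mul_prod (lam := lam) hθ Finset.univ ha).bdd_mul
    hmeas.aestronglyMeasurable hbound).congr (.of_forall fun x => ?_)
  simp only [charWeight, Finset.prod_inv_distrib]
  ring

theorem integrableOn_weightedPower (hθ : 0 < θ) (ha : -1 < a)
    (hκ : ∀ i, ∀ t : ℝ, 0 ≤ t → κ i ≠ (t : ℂ)) (j : ℕ) :
    IntegrableOn (weightedPower θ a κ lam j) (Set.Ioi 0) := by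
  have haj : -1 < a + θ * j := lt_add_of_lt_of_nonneg ha (by positivity)
  refine (integrableOn_charWeight (lam := lam) hθ haj hκ).congr ?_
  filter_upwards [ae_restrict_mem measurableSet_Ioi] with x hx
  rw [charWeight_add _ hx, Real.rpow_mul (le_of_lt hx), Real.rpow_natCast, weightedPower]

end Convergence

section PartitionFunctions

theorem ae_restrict_Ioi_pos : ∀ᵐ x : ℝ ∂volume.restrict (Set.Ioi 0), 0 < x :=
  ae_restrict_mem measurableSet_Ioi

theorem volume_restrict_orthant (N : ℕ) :
    volume.restrict (orthant N) = Measure.pi fun _ => volume.restrict (Set.Ioi 0) :=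
  Measure.restrict_pi_pi _ _

theorem volume_restrict_orthant_prod (N : ℕ) :
    volume.restrict (orthant N ×ˢ orthant N) =
      (Measure.pi fun _ => volume.restrict (Set.Ioi 0)).prod
        (Measure.pi fun _ => volume.restrict (Set.Ioi 0)) := by
  rw [Measure.volume_eq_prod, ← Measure.prod_restrict, volume_restrict_orthant]

theorem two_pow_mul_cauchyIntegrand_ae_eq (N : ℕ) (θ a : ℝ) (κ : Fin k → ℂ) (lam : Fin l → ℂ) :
    (fun p => 2 ^ N * cauchyIntegrand θ a (a + 1) κ lam κ lam p)
      =ᵐ[(Measure.pi fun _ : Fin N => volume.restrict (Set.Ioi 0)).prod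
        (Measure.pi fun _ : Fin N => volume.restrict (Set.Ioi 0))] fun p =>
      (Matrix.of fun i j => ((1 + schurKernel (p.1 i) (p.2 j) : ℝ) : ℂ)).det *
        (slaterDet (fun j : Fin N => weightedPower θ a κ lam j) p.1 *
          slaterDet (fun j : Fin N => weightedPower θ a κ lam j) p.2) := by
  filter_upwards [Measure.quasiMeasurePreserving_fst.ae (ae_pi_pos ae_restrict_Ioi_pos N),
    Measure.quasiMeasurePreserving_snd.ae (ae_pi_pos ae_restrict_Ioi_pos N)] with p hp₁ hp₂
  exact two_pow_mul_cauchyIntegrand_eq hp₁ hp₂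

variable {N : ℕ} (hint : ∀ j < N, IntegrableOn (weightedPower θ a κ lam j) (Set.Ioi 0))
include hint

theorem integrableOn_buresIntegrand :
    IntegrableOn (buresIntegrand (N := N) θ a κ lam) (orthant N) := by
  rw [IntegrableOn, volume_restrict_orthant, funext buresIntegrand_eq_schurProd_mul_slaterDet]
  exact integrable_mul_slaterDet ofReal_schurProd_comp_perm
    (integrable_schurProd_mul_prod ae_restrict_Ioi_pos fun i => ⟨_, hint i i.isLt⟩)

theorem integrableOn_cauchyIntegrand :
    IntegrableOn (cauchyIntegrand (N := N) θ a (a + 1) κ lam κ lam) (orthant N ×ˢ orthant N) := by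
  rw [IntegrableOn, volume_restrict_orthant_prod,
    ← integrable_const_mul_iff (pow_ne_zero N (two_ne_zero' ℂ)).isUnit,
    integrable_congr (two_pow_mul_cauchyIntegrand_ae_eq N θ a κ lam)]
  exact integrable_det_mul_slaterDet_mul_slaterDet
    (q := fun s t => ((1 + schurKernel s t : ℝ) : ℂ)) fun i j =>
      integrable_one_add_schurKernel_mul_mul ae_restrict_Ioi_pos ⟨_, hint i i.isLt⟩
        ⟨_, hint j j.isLt⟩

theorem sq_buresZ_eq_two_pow_mul_cauchyZ :
    buresZ N θ a κ lam ^ 2 = 2 ^ N * cauchyZ N θ a (a + 1) κ lam κ lam := by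
  rw [buresZ, cauchyZ, mul_pow, volume_restrict_orthant, volume_restrict_orthant_prod,
    mul_left_comm, ← integral_const_mul,
    integral_congr_ae (two_pow_mul_cauchyIntegrand_ae_eq N θ a κ lam),
    ← sq_integral_schurProd_mul_slaterDet ae_restrict_Ioi_pos fun j => hint j j.isLt, one_div_pow]
  simp only [buresIntegrand_eq_schurProd_mul_slaterDet]

end PartitionFunctions

end Models

end ThetaBures

theorem mainTheorem12_general (N k l : ℕ) (θ a : ℝ) (κ : Fin k → ℂ) (lam : Fin l → ℂ)
    (hint : ∀ j < N, IntegrableOn (ThetaBures.weightedPower θ a κ lam j) (Set.Ioi 0)) :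
    MeasureTheory.IntegrableOn
      (ThetaBures.buresIntegrand (N := N) θ a κ lam) (ThetaBures.orthant N) ∧
    MeasureTheory.IntegrableOn
      (ThetaBures.cauchyIntegrand (N := N) θ a (a + 1) κ lam κ lam)
      (ThetaBures.orthant N ×ˢ ThetaBures.orthant N) ∧
    (ThetaBures.buresZ N θ a κ lam) ^ 2 =
      2 ^ N * ThetaBures.cauchyZ N θ a (a + 1) κ lam κ lam :=
  ⟨ThetaBures.integrableOn_buresIntegrand hint, ThetaBures.integrableOn_cauchyIntegrand hint,
    ThetaBures.sq_buresZ_eq_two_pow_mul_cauchyZ hint⟩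

theorem mainTheorem12 (N k l : ℕ) (θ a : ℝ) (hθ : 0 < θ) (ha : -1 < a)
    (κ : Fin k → ℂ) (lam : Fin l → ℂ) (hκ : ∀ i, ∀ t : ℝ, 0 ≤ t → κ i ≠ (t : ℂ)) :
    MeasureTheory.IntegrableOn
      (ThetaBures.buresIntegrand (N := N) θ a κ lam) (ThetaBures.orthant N) ∧
    MeasureTheory.IntegrableOn
      (ThetaBures.cauchyIntegrand (N := N) θ a (a + 1) κ lam κ lam)
      (ThetaBures.orthant N ×ˢ ThetaBures.orthant N) ∧
    (ThetaBures.buresZ N θ a κ lam) ^ 2 =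
      2 ^ N * ThetaBures.cauchyZ N θ a (a + 1) κ lam κ lam :=
  mainTheorem12_general N k l θ a κ lam fun j _ => ThetaBures.integrableOn_weightedPower hθ ha hκ j
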